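/- All graphs are finite, simple, undirected and connected, and $\partial$ denotes the path-length distance. Let $\Gamma$ be a graph with vertex set $V$; put $\Gamma_i(x)=\{y\in V:\partial(x,y)=i\}$, and let $\Gamma(x)=\Gamma_1(x)$ be the set of neighbours of $x$. A vertex $x$ is *distance-regularized* if for every $i\ge 0$ the numbers $$a_i(x,y)=|\Gamma_i(x)\cap\Gamma(y)|,\qquad b_i(x,y)=|\Gamma_{i+1}(x)\cap\Gamma(y)|,\qquad c_i(x,y)=|\Gamma_{i-1}(x)\cap\Gamma(y)|$$ do not depend on the choice of $y\in\Gamma_i(x)$. A *$(Y,Y')$-bipartite distance-regularized graph* is a connected bipartite graph with colour classes $Y$, $Y'$ (so $V$ is the disjoint union of $Y$ and $Y'$, and every edge joins $Y$ to $Y'$) all of whose vertices are distance-regularized. In such a graph, $D$ denotes the common eccentricity of the vertices in $Y$, and $c_2'$ denotes the common value of $c_2(z,w)$ for $z\in Y'$ and $w\in\Gamma_2(z)$, i.e. the number of common neighbours of two vertices of $Y'$ at distance $2$. For $D\ge 3$ the graph is *$2$-$Y$-homogeneous* if for every $i$ with $1\le i\le D-1$ the number of common neighbours of $x$ and $y$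 that are at distance $i-1$ from $z$ is the same for all $x\in Y$, $y\in\Gamma_2(x)$ and $z\in\Gamma_i(x)\cap\Gamma_i(y)$ (it may depend on $i$). The *subdivision graph* of a graph $H$ has as vertices the vertices and the edges of $H$, a vertex of $H$ being adjacent to exactly the edges of $H$ that contain it. **Theorem.** Let $\Gamma$ be a $(Y,Y')$-bipartite distance-regularized graph. The following are equivalent: (i) $\Gamma$ is $2$-$Y$-homogeneous with $D=4$ and $c_2'=1$. (ii) For some $n\ge 2$ there is an isomorphism from $\Gamma$ onto the subdivision graph of the complete bipartite graph $K_{n,n}$ which maps $Y$ onto the vertex set of $K_{n,n}$. -/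

import Mathlib

/-- `Γ_i(x)`: the set of vertices at distance `i` from `x`. -/
def distSphere {V : Type*} (G : SimpleGraph V) (i : ℕ) (x : V) : Set V :=
  {y | G.dist x y = i}

/-- `a_i(x,y) = |Γ_i(x) ∩ Γ(y)|`. -/
noncomputable def aNum {V : Type*} (G : SimpleGraph V) (i : ℕ) (x y : V) : ℕ :=
  (distSphere G i x ∩ G.neighborSet y).ncard

/-- `b_i(x,y) = |Γ_{i+1}(x) ∩ Γ(y)|`. -/
noncomputable def bNum {V : Type*} (G : SimpleGraph V) (i : ℕ) (x y : V) : ℕ :=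
  (distSphere G (i + 1) x ∩ G.neighborSet y).ncard

/-- `c_i(x,y) = |Γ_{i-1}(x) ∩ Γ(y)|`, where `Γ_{-1}(x)` is empty. -/
noncomputable def cNum {V : Type*} (G : SimpleGraph V) (i : ℕ) (x y : V) : ℕ :=
  ({z | G.dist x z + 1 = i} ∩ G.neighborSet y).ncard

/-- `x` is distance-regularized: for every `i`, the numbers `a_i(x,y)`, `b_i(x,y)`, `c_i(x,y)`
do not depend on the choice of `y ∈ Γ_i(x)`. -/
def IsDistanceRegularizedVertex {V : Type*} (G : SimpleGraph V) (x : V) : Prop :=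
  ∀ i : ℕ, ∀ y ∈ distSphere G i x, ∀ y' ∈ distSphere G i x,
    aNum G i x y = aNum G i x y' ∧ bNum G i x y = bNum G i x y' ∧ cNum G i x y = cNum G i x y'

/-- A `(Y,Y')`-bipartite distance-regularized graph: a connected bipartite graph with color
partitions `Y`, `Y'` all of whose vertices are distance-regularized. -/
structure IsBipartiteDistanceRegularized {V : Type*} (G : SimpleGraph V) (Y Y' : Set V) :
    Prop where
  connected : G.Connected
  bipartite : G.IsBipartiteWith Y Y'
  cover : Y ∪ Y' = Set.univ
  regularized : ∀ x, IsDistanceRegularizedVertex G x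

/-- The vertices of the color class `Y` have common eccentricity `D`
(`Y` is nonempty, so that `D` is determined by this). -/
def HasCommonEccentricity {V : Type*} (G : SimpleGraph V) (Y : Set V) (D : ℕ) : Prop :=
  Y.Nonempty ∧ ∀ x ∈ Y, G.eccent x = D

/-- The intersection number `c_i` of the vertices of the color class `Z` is defined with
`i` at most their eccentricity, and equals `c`: for each `x ∈ Z` the set `Γ_i(x)` is nonempty and
`c_i(x,y) = c` for all `y ∈ Γ_i(x)`. -/
def HasIntersectionNumberC {V : Type*} (G : SimpleGraph V) (Z : Set V) (i c : ℕ) : Prop :=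
  Z.Nonempty ∧ ∀ x ∈ Z, (distSphere G i x).Nonempty ∧ ∀ y ∈ distSphere G i x, cNum G i x y = c

/-- `G` is `2`-`Y`-homogeneous, where `D` is the common eccentricity of the vertices of `Y`:
for every `i` with `1 ≤ i ≤ D - 1`, the number of common neighbours of `x` and `y` at distance
`i - 1` from `z` is the same for all `x ∈ Y`, `y ∈ Γ_2(x)` and `z ∈ Γ_i(x) ∩ Γ_i(y)`. -/
def IsTwoHomogeneous {V : Type*} (G : SimpleGraph V) (Y : Set V) (D : ℕ) : Prop :=
  ∀ i : ℕ, 1 ≤ i → i + 1 ≤ D → ∃ γ : ℕ,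
    ∀ x ∈ Y, ∀ y ∈ distSphere G 2 x, ∀ z ∈ distSphere G i x ∩ distSphere G i y,
      (G.commonNeighbors x y ∩ distSphere G (i - 1) z).ncard = γ

/-- The subdivision graph of `H`: its vertices are the vertices (`Sum.inl`) and the edges
(`Sum.inr`) of `H`, and a vertex of `H` is adjacent to the edges of `H` that contain it. -/
def subdivisionGraph {W : Type*} (H : SimpleGraph W) : SimpleGraph (W ⊕ H.edgeSet) where
  Adj
    | Sum.inl v, Sum.inr e => v ∈ e.1
    | Sum.inr e, Sum.inl v => v ∈ e.1
    | _, _ => False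
  symm := ⟨by rintro (a | a) (b | b) h <;> exact h⟩
  loopless := ⟨by rintro (a | a) h <;> exact h⟩

/-! Read `Y` as points and its complement as lines. Then `c_2' = 1` says that two lines meet in at
most one point, so `Γ` is the incidence graph of a partial linear space (`IsPartialLinear`), and
regularity gives all lines the same size.

If lines had three points, the homogeneity constants for `i = 2` and `i = 3` would both be nonzero.
The second would force two lines through `x` to meet a common third line, and the first would forbid
the resulting triangle (`ncard_neighborSet_le_two`). So lines are edges of a graph on `Y`.

Since `c_3 = 1` for points, an edge missing `x` has exactly one end adjacent to `x`
(`dist_eq_two_iff_of_not_adj`). Hence the neighbours of `x` and the remaining points form a complete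
bipartite graph, whose parts have equal size because degrees are constant
(`exists_isBicliqueSubdivision`).

The converse is a direct check, with homogeneity constants `1, 0, 0`. -/

namespace SimpleGraph

/-! ### Distances and degrees in bipartite graphs. -/

variable {V : Type*} {G : SimpleGraph V} {Y : Set V}

/-- Distances in a connected graph with bipartition `Y`, `Yᶜ` are even exactly between vertices
of the same colour class. -/
theorem even_dist_iff (hc : G.Connected) (hb : ∀ u v, G.Adj u v → (u ∈ Y ↔ v ∉ Y)) (u v : V) :
    Even (G.dist u v) ↔ (u ∈ Y ↔ v ∈ Y) := by
  classical
  obtain ⟨p, hp⟩ := hc.exists_walk_length_eq_dist u v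
  let c : G.Coloring Bool := Coloring.mk (fun v ↦ decide (v ∈ Y)) (by
    intro a b hab h
    have := hb a b hab
    simp only [decide_eq_decide] at h
    tauto)
  have h := c.even_length_iff_congr p
  rw [hp] at h
  rw [h, ← Bool.eq_iff_iff]
  exact decide_eq_decide

theorem dist_eq_two_iff (hc : G.Connected) (hb : ∀ u v, G.Adj u v → (u ∈ Y ↔ v ∉ Y)) (u v : V) :
    G.dist u v = 2 ↔ u ≠ v ∧ ∃ w, G.Adj u w ∧ G.Adj v w := by
  constructor
  · intro h
    refine ⟨?_, ?_⟩
    · rintro rfl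
      simp at h
    · obtain ⟨p, hp⟩ := hc.exists_walk_length_eq_dist u v
      rw [h] at hp
      match p, hp with
      | .cons h1 (.cons h2 .nil), _ => exact ⟨_, h1, h2.symm⟩
  · rintro ⟨hne, w, hu, hv⟩
    have h1 : G.dist u v ≤ 2 := dist_le (.cons hu (.cons hv.symm .nil))
    have h2 := hc.pos_dist_of_ne hne
    have h3 := (even_dist_iff hc hb u v).2 (by have := hb u w hu; have := hb v w hv; tauto)
    obtain ⟨k, hk⟩ := h3
    omega

/-- A vertex at distance `4` is joined by a path of length `4`. -/
theorem exists_path_of_dist_eq_four (hc : G.Connected) {u v : V} (h : G.dist u v = 4) :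
    ∃ a b c, G.Adj u a ∧ G.Adj a b ∧ G.Adj b c ∧ G.Adj c v := by
  obtain ⟨p, hp⟩ := hc.exists_walk_length_eq_dist u v
  rw [h] at hp
  match p, hp with
  | .cons h1 (.cons h2 (.cons h3 (.cons h4 .nil))), _ => exact ⟨_, _, _, h1, h2, h3, h4⟩

theorem dist_le_of_eccent_eq (hc : G.Connected) {x : V} {D : ℕ} (h : G.eccent x = D) (v : V) :
    G.dist x v ≤ D := by
  have h1 := G.edist_le_eccent (u := x) (v := v)
  rw [h, ← (hc.preconnected x v).coe_dist_eq_edist] at h1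
  exact_mod_cast h1

theorem exists_dist_eq_of_eccent_eq [Finite V] (hc : G.Connected) {x : V} {D : ℕ}
    (h : G.eccent x = D) : ∃ v, G.dist x v = D := by
  have := hc.nonempty
  obtain ⟨v, hv⟩ := G.exists_edist_eq_eccent_of_finite x
  refine ⟨v, ?_⟩
  rw [h, ← (hc.preconnected x v).coe_dist_eq_edist] at hv
  exact_mod_cast hv

theorem eccent_eq_of_dist (hc : G.Connected) {x v : V} {D : ℕ} (hle : ∀ u, G.dist x u ≤ D)
    (hv : G.dist x v = D) : G.eccent x = D := by
  apply le_antisymm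
  · rw [eccent_le_iff]
    intro u
    rw [← (hc.preconnected x u).coe_dist_eq_edist]
    exact_mod_cast hle u
  · rw [← hv, (hc.preconnected x v).coe_dist_eq_edist]
    exact G.edist_le_eccent

/-- A bipartite graph has no triangles, so every neighbour of `v` other than `m` is at distance `2`
from `m`. -/
theorem bNum_one_add_one_eq_ncard_neighborSet [Finite V] (hc : G.Connected)
    (hb : ∀ u v, G.Adj u v → (u ∈ Y ↔ v ∉ Y)) {m v : V} (h : G.Adj m v) :
    bNum G 1 m v + 1 = (G.neighborSet v).ncard := by
  have hm : m ∈ G.neighborSet v := h.symm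
  rw [← Set.ncard_sdiff_singleton_add_one hm]
  unfold bNum
  congr 2
  ext z
  simp only [distSphere, Set.mem_inter_iff, Set.mem_ofPred_eq, mem_neighborSet, Set.mem_sdiff,
    Set.mem_singleton_iff, Nat.reduceAdd, dist_eq_two_iff hc hb]
  constructor
  · rintro ⟨⟨h1, -⟩, h2⟩
    exact ⟨h2, fun h ↦ h1 h.symm⟩
  · rintro ⟨h1, h2⟩
    exact ⟨⟨fun h ↦ h2 h.symm, v, h, h1.symm⟩, h1⟩

/-- Two neighbours of a distance-regularized vertex have the same degree. -/
theorem ncard_neighborSet_eq_of_adj [Finite V] (hc : G.Connected)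
    (hb : ∀ u v, G.Adj u v → (u ∈ Y ↔ v ∉ Y)) {m u v : V}
    (hm : IsDistanceRegularizedVertex G m) (hu : G.Adj u m) (hv : G.Adj v m) :
    (G.neighborSet u).ncard = (G.neighborSet v).ncard := by
  rw [← bNum_one_add_one_eq_ncard_neighborSet hc hb hu.symm,
    ← bNum_one_add_one_eq_ncard_neighborSet hc hb hv.symm,
    (hm 1 u (dist_eq_one_iff_adj.2 hu.symm) v (dist_eq_one_iff_adj.2 hv.symm)).2.1]

end SimpleGraph

/-! ### An intrinsic form of the subdivision of `K_{n,n}`. -/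

/-- The vertices of `A` and `B` are the vertices of a complete bipartite graph, the vertices outside
`A ∪ B` its edges, and adjacency in `G` is incidence. -/
structure IsBicliqueSubdivision {V : Type*} (G : SimpleGraph V) (Y A B : Set V) : Prop where
  union_eq : A ∪ B = Y
  disjoint : Disjoint A B
  ncard_eq : A.ncard = B.ncard
  two_le : 2 ≤ A.ncard
  ends : ∀ w ∉ Y, ∃ p ∈ A, ∃ q ∈ B, ∀ v, G.Adj v w ↔ v = p ∨ v = q
  join : ∀ p ∈ A, ∀ q ∈ B, ∃ w, G.Adj p w ∧ G.Adj q w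
  unique : ∀ p ∈ A, ∀ q ∈ B, ∀ w w', G.Adj p w → G.Adj q w → G.Adj p w' → G.Adj q w' → w = w'

namespace IsBicliqueSubdivision

variable {V : Type*} {G : SimpleGraph V} {Y A B : Set V}

theorem exists_iso [Finite V] (h : IsBicliqueSubdivision G Y A B)
    (hb : ∀ u v, G.Adj u v → (u ∈ Y ↔ v ∉ Y)) :
    ∃ φ : G ≃g subdivisionGraph (completeBipartiteGraph (Fin A.ncard) (Fin A.ncard)),
      φ '' Y = Set.range Sum.inl := by
  classical
  set n := A.ncard with hn
  have eA : Fin n ≃ A := (Finite.equivFinOfCardEq rfl).symm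
  have eB : Fin n ≃ B := (Finite.equivFinOfCardEq (hn.trans h.ncard_eq).symm).symm
  let e : Fin n ⊕ Fin n → V := Sum.elim (fun i ↦ eA i) (fun j ↦ eB j)
  have hdisj : ∀ v, v ∈ A → v ∈ B → False := fun v ha hB ↦ Set.disjoint_left.1 h.disjoint ha hB
  have heY : ∀ a, e a ∈ Y := by
    rw [← h.union_eq]
    rintro (i | j)
    · exact Or.inl (eA i).2
    · exact Or.inr (eB j).2
  have hinj : Function.Injective e := by
    rintro (i | i) (j | j) hij
    · exact congrArg Sum.inl (eA.injective (Subtype.ext hij))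
    · have hij : (eA i : V) = eB j := hij
      exact (hdisj _ (eA i).2 (hij ▸ (eB j).2)).elim
    · have hij : (eB i : V) = eA j := hij
      exact (hdisj _ (eA j).2 (hij ▸ (eB i).2)).elim
    · exact congrArg Sum.inr (eB.injective (Subtype.ext hij))
  have hsurj : ∀ v ∈ Y, ∃ a, e a = v := by
    rw [← h.union_eq]
    rintro v (hv | hv)
    · exact ⟨.inl (eA.symm ⟨v, hv⟩), by simp [e]⟩
    · exact ⟨.inr (eB.symm ⟨v, hv⟩), by simp [e]⟩
  -- The vertex joining the two chosen points has one end in each part, so these points are all its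
  -- ends.
  have key : ∀ i j, ∃ w, w ∉ Y ∧ ∀ a, G.Adj (e a) w ↔ a ∈ s(Sum.inl i, Sum.inr j) := by
    intro i j
    obtain ⟨w, hp, hq⟩ := h.join _ (eA i).2 _ (eB j).2
    have hw : w ∉ Y := (hb _ _ hp).1 (heY (.inl i))
    obtain ⟨p, hpA, q, hqB, hpq⟩ := h.ends w hw
    have h1 : e (.inl i) = p := by
      rcases (hpq _).1 hp with h1 | h1
      · exact h1
      · exact (hdisj _ (eA i).2 (h1 ▸ hqB)).elim
    have h2 : e (.inr j) = q := by
      rcases (hpq _).1 hq with h1 | h1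
      · exact (hdisj _ (h1 ▸ hpA) (eB j).2).elim
      · exact h1
    refine ⟨w, hw, fun a ↦ ?_⟩
    rw [hpq, ← h1, ← h2, hinj.eq_iff, hinj.eq_iff, Sym2.mem_iff]
  have key' : ∀ s : (completeBipartiteGraph (Fin n) (Fin n)).edgeSet,
      ∃ w, w ∉ Y ∧ ∀ a, G.Adj (e a) w ↔ a ∈ s.1 := by
    rintro ⟨s, hs⟩
    induction s with
    | _ a b =>
      rcases a with i | i <;> rcases b with j | j
      · simp at hs
      · exact key i j
      · simpa [Sym2.eq_swap] using key j i
      · simp at hs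
  choose l hlY hl using key'
  let g : (Fin n ⊕ Fin n) ⊕ (completeBipartiteGraph (Fin n) (Fin n)).edgeSet → V := Sum.elim e l
  have hg : Function.Bijective g := by
    constructor
    · rintro (a | s) (b | t) hst
      · exact congrArg Sum.inl (hinj hst)
      · have hst : e a = l t := hst
        exact (hlY t (hst ▸ heY a)).elim
      · have hst : l s = e b := hst
        exact (hlY s (hst ▸ heY b)).elim
      · have hst : l s = l t := hst
        -- An edge is determined by its ends, which `hl` reads off from adjacency in `G`.
        refine congrArg Sum.inr (Subtype.ext (Sym2.ext fun a ↦ ?_))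
        rw [← hl, ← hl, hst]
    · intro v
      by_cases hv : v ∈ Y
      · obtain ⟨a, ha⟩ := hsurj v hv
        exact ⟨.inl a, ha⟩
      · obtain ⟨p, hpA, q, hqB, hpq⟩ := h.ends v hv
        let i := eA.symm ⟨p, hpA⟩
        let j := eB.symm ⟨q, hqB⟩
        have hi : e (.inl i) = p := by simp [e, i]
        have hj : e (.inr j) = q := by simp [e, j]
        let s : (completeBipartiteGraph (Fin n) (Fin n)).edgeSet := ⟨s(.inl i, .inr j), by simp⟩
        refine ⟨.inr s, h.unique p hpA q hqB _ _ ?_ ?_ ((hpq p).2 (.inl rfl)) ((hpq q).2 (.inr rfl))⟩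
        · rw [← hi]
          exact (hl s _).2 (Sym2.mem_mk_left _ _)
        · rw [← hj]
          exact (hl s _).2 (Sym2.mem_mk_right _ _)
  let ψ : subdivisionGraph (completeBipartiteGraph (Fin n) (Fin n)) ≃g G :=
    { toEquiv := Equiv.ofBijective g hg
      map_rel_iff' := by
        rintro (a | s) (b | t)
        · change G.Adj (e a) (e b) ↔ False
          refine iff_false_intro fun hab ↦ (hb _ _ hab).1 (heY a) (heY b)
        · exact hl t a
        · exact (G.adj_comm _ _).trans (hl s b)
        · change G.Adj (l s) (l t) ↔ False
          refine iff_false_intro fun hab ↦ hlY s ((hb _ _ hab).2 (hlY t)) }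
  refine ⟨ψ.symm, ?_⟩
  ext x
  constructor
  · rintro ⟨y, hy, rfl⟩
    obtain ⟨a, rfl⟩ := hsurj y hy
    exact ⟨a, (ψ.symm_apply_apply (.inl a)).symm⟩
  · rintro ⟨a, rfl⟩
    exact ⟨e a, heY a, ψ.symm_apply_apply (.inl a)⟩

theorem of_iso [Finite V] {n : ℕ} (hn : 2 ≤ n)
    (φ : G ≃g subdivisionGraph (completeBipartiteGraph (Fin n) (Fin n)))
    (hφ : φ '' Y = Set.range Sum.inl) :
    IsBicliqueSubdivision G Y (Set.range fun i ↦ φ.symm (.inl (.inl i)))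
      (Set.range fun i ↦ φ.symm (.inl (.inr i))) := by
  have hY : ∀ v, v ∈ Y ↔ ∃ a, v = φ.symm (.inl a) := by
    intro v
    rw [← φ.injective.mem_set_image, hφ]
    constructor
    · rintro ⟨a, ha⟩
      exact ⟨a, by rw [ha]; simp⟩
    · rintro ⟨a, rfl⟩
      exact ⟨a, by simp⟩
  have hadj : ∀ v w, G.Adj v w ↔
      (subdivisionGraph (completeBipartiteGraph (Fin n) (Fin n))).Adj (φ v) (φ w) :=
    fun v w ↦ φ.map_adj_iff.symm
  have hA : (Set.range fun i ↦ φ.symm (.inl (.inl i))).ncard = n := by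
    rw [← Set.image_univ, Set.ncard_image_of_injective _ (fun i j hij ↦ by simpa using hij)]
    simp
  have hB : (Set.range fun i ↦ φ.symm (.inl (.inr i))).ncard = n := by
    rw [← Set.image_univ, Set.ncard_image_of_injective _ (fun i j hij ↦ by simpa using hij)]
    simp
  refine ⟨?_, ?_, hA.trans hB.symm, hn.trans_eq hA.symm, ?_, ?_, ?_⟩
  · ext v
    rw [hY]
    constructor
    · rintro (⟨i, rfl⟩ | ⟨i, rfl⟩)
      exacts [⟨_, rfl⟩, ⟨_, rfl⟩]
    · rintro ⟨i | i, rfl⟩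
      exacts [.inl ⟨i, rfl⟩, .inr ⟨i, rfl⟩]
  · rw [Set.disjoint_left]
    rintro _ ⟨i, rfl⟩ ⟨j, hj⟩
    simp at hj
  · intro w hw
    obtain ⟨x, rfl⟩ := φ.symm.surjective w
    rcases x with a | ⟨s, hs⟩
    · exact (hw ((hY _).2 ⟨a, rfl⟩)).elim
    have key : ∀ i j, s = s(.inl i, .inr j) → ∃ p ∈ (Set.range fun i ↦ φ.symm (.inl (.inl i))),
        ∃ q ∈ (Set.range fun i ↦ φ.symm (.inl (.inr i))),
          ∀ v, G.Adj v (φ.symm (.inr ⟨s, hs⟩)) ↔ v = p ∨ v = q := by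
      rintro i j rfl
      refine ⟨_, ⟨i, rfl⟩, _, ⟨j, rfl⟩, fun v ↦ ?_⟩
      obtain ⟨x, rfl⟩ := φ.symm.surjective v
      simp only [hadj, RelIso.apply_symm_apply, φ.symm.injective.eq_iff]
      rcases x with a | t
      · simp [subdivisionGraph]
      · simp [subdivisionGraph]
    induction s with
    | _ a b =>
      rcases a with i | i <;> rcases b with j | j
      · simp at hs
      · exact key i j rfl
      · exact key j i Sym2.eq_swap
      · simp at hs
  · rintro _ ⟨i, rfl⟩ _ ⟨j, rfl⟩
    refine ⟨φ.symm (.inr ⟨s(.inl i, .inr j), by simp⟩), ?_, ?_⟩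
    · rw [hadj, RelIso.apply_symm_apply, RelIso.apply_symm_apply]
      exact Sym2.mem_mk_left _ _
    · rw [hadj, RelIso.apply_symm_apply, RelIso.apply_symm_apply]
      exact Sym2.mem_mk_right _ _
  · rintro _ ⟨i, rfl⟩ _ ⟨j, rfl⟩ w w'
    obtain ⟨x, rfl⟩ := φ.symm.surjective w
    obtain ⟨x', rfl⟩ := φ.symm.surjective w'
    simp only [hadj, RelIso.apply_symm_apply, φ.symm.injective.eq_iff]
    rcases x with a | s <;> rcases x' with a' | s' <;> simp only [subdivisionGraph] <;> try tauto
    intro h1 h2 h3 h4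
    refine congrArg Sum.inr (Subtype.ext ?_)
    rw [(Sym2.mem_and_mem_iff (by simp)).1 ⟨h1, h2⟩, (Sym2.mem_and_mem_iff (by simp)).1 ⟨h3, h4⟩]

end IsBicliqueSubdivision

/-! ### The subdivision of `K_{n,n}` satisfies (i). -/

namespace IsBicliqueSubdivision

open SimpleGraph

variable {V : Type*} {G : SimpleGraph V} {Y A B : Set V}

theorem symm (h : IsBicliqueSubdivision G Y A B) : IsBicliqueSubdivision G Y B A where
  union_eq := by rw [Set.union_comm, h.union_eq]
  disjoint := h.disjoint.symm
  ncard_eq := h.ncard_eq.symm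
  two_le := h.ncard_eq ▸ h.two_le
  ends w hw := by
    obtain ⟨p, hp, q, hq, hpq⟩ := h.ends w hw
    exact ⟨q, hq, p, hp, fun v ↦ (hpq v).trans or_comm⟩
  join p hp q hq := by
    obtain ⟨w, h1, h2⟩ := h.join q hq p hp
    exact ⟨w, h2, h1⟩
  unique p hp q hq w w' h1 h2 h3 h4 := h.unique q hq p hp w w' h2 h1 h4 h3

/-- Vertices of the biclique with a common edge lie in different parts. -/
theorem mem_left_iff (h : IsBicliqueSubdivision G Y A B) {x y w : V} (hw : w ∉ Y) (hxy : x ≠ y)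
    (hx : G.Adj x w) (hy : G.Adj y w) : x ∈ A ↔ y ∉ A := by
  obtain ⟨p, hp, q, hq, hpq⟩ := h.ends w hw
  have hqA : q ∉ A := fun hqA ↦ Set.disjoint_left.1 h.disjoint hqA hq
  rcases (hpq x).1 hx with rfl | rfl <;> rcases (hpq y).1 hy with rfl | rfl <;> tauto

theorem unique' (h : IsBicliqueSubdivision G Y A B) {x y w w' : V} (hw : w ∉ Y)
    (hxy : x ≠ y) (hx : G.Adj x w) (hy : G.Adj y w) (hx' : G.Adj x w') (hy' : G.Adj y w') :
    w = w' := by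
  obtain ⟨p, hp, q, hq, hpq⟩ := h.ends w hw
  rcases (hpq x).1 hx with rfl | rfl <;> rcases (hpq y).1 hy with rfl | rfl
  · exact (hxy rfl).elim
  · exact h.unique _ hp _ hq _ _ hx hy hx' hy'
  · exact h.unique _ hp _ hq _ _ hy hx hy' hx'
  · exact (hxy rfl).elim

theorem eq_or_eq (h : IsBicliqueSubdivision G Y A B) {x y z w : V} (hw : w ∉ Y) (hxy : x ≠ y)
    (hx : G.Adj x w) (hy : G.Adj y w) (hz : G.Adj z w) : z = x ∨ z = y := by
  obtain ⟨p, hp, q, hq, hpq⟩ := h.ends w hw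
  have h1 := (hpq x).1 hx
  have h2 := (hpq y).1 hy
  have h3 := (hpq z).1 hz
  grind

/-- The extreme distance is attained at another vertex of the same part, reached through the
opposite part; it exists because `2 ≤ A.ncard`. -/
theorem eccent_eq_of_mem_left [Finite V] (h : IsBicliqueSubdivision G Y A B) (hc : G.Connected)
    (hb : ∀ u v, G.Adj u v → (u ∈ Y ↔ v ∉ Y)) {x : V} (hx : x ∈ A) : G.eccent x = (4 : ℕ) := by
  have hAY : A ⊆ Y := h.union_eq ▸ Set.subset_union_left
  have hBY : B ⊆ Y := h.union_eq ▸ Set.subset_union_right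
  have hB : ∀ q ∈ B, G.dist x q = 2 := by
    intro q hq
    rw [dist_eq_two_iff hc hb]
    exact ⟨fun hxq ↦ Set.disjoint_left.1 h.disjoint hx (hxq ▸ hq), h.join x hx q hq⟩
  have hA : ∀ p ∈ A, G.dist x p ≤ 4 := by
    intro p hp
    have hBc := h.symm.two_le
    obtain ⟨q, hq⟩ := Set.nonempty_of_ncard_ne_zero (s := B) (by omega)
    have h1 := hB q hq
    have h2 : G.dist q p = 2 := by
      rw [dist_eq_two_iff hc hb]
      exact ⟨fun hxq ↦ Set.disjoint_left.1 h.disjoint hp (hxq ▸ hq), h.symm.join q hq p hp⟩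
    have := hc.dist_triangle (u := x) (v := q) (w := p)
    omega
  have hle : ∀ u, G.dist x u ≤ 4 := by
    intro u
    by_cases hu : u ∈ Y
    · rw [← h.union_eq] at hu
      rcases hu with hu | hu
      · exact hA u hu
      · exact (hB u hu).le.trans (by norm_num)
    · obtain ⟨p, hp, q, hq, hpq⟩ := h.ends u hu
      have h1 := hB q hq
      have h2 := dist_eq_one_iff_adj.2 ((hpq q).2 (.inr rfl))
      have := hc.dist_triangle (u := x) (v := q) (w := u)
      omega
  obtain ⟨y, hy, hyx⟩ := Set.exists_ne_of_one_lt_ncard h.two_le x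
  refine eccent_eq_of_dist hc hle (v := y) ?_
  have h2 : G.dist x y ≠ 2 := by
    rw [Ne, dist_eq_two_iff hc hb]
    rintro ⟨hne, w, h1, h2⟩
    exact (h.mem_left_iff ((hb _ _ h1).1 (hAY hx)) hne h1 h2).1 hx hy
  have hpos := hc.pos_dist_of_ne hyx.symm
  obtain ⟨k, hk⟩ := (even_dist_iff hc hb x y).2 (iff_of_true (hAY hx) (hAY hy))
  have := hle y
  omega

theorem hasCommonEccentricity [Finite V] (h : IsBicliqueSubdivision G Y A B) (hc : G.Connected)
    (hb : ∀ u v, G.Adj u v → (u ∈ Y ↔ v ∉ Y)) : HasCommonEccentricity G Y 4 := by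
  constructor
  · rw [← h.union_eq]
    have := h.two_le
    exact (Set.nonempty_of_ncard_ne_zero (s := A) (by omega)).mono Set.subset_union_left
  · rw [← h.union_eq]
    rintro x (hx | hx)
    exacts [h.eccent_eq_of_mem_left hc hb hx, h.symm.eccent_eq_of_mem_left hc hb hx]

theorem isTwoHomogeneous [Finite V] (h : IsBicliqueSubdivision G Y A B) (hc : G.Connected)
    (hb : ∀ u v, G.Adj u v → (u ∈ Y ↔ v ∉ Y)) : IsTwoHomogeneous G Y 4 := by
  intro i hi hi'
  obtain rfl | rfl | rfl : i = 1 ∨ i = 2 ∨ i = 3 := by omega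
  · refine ⟨1, fun x hx y hy z hz ↦ ?_⟩
    have hxz : G.Adj x z := dist_eq_one_iff_adj.1 hz.1
    have hyz : G.Adj y z := dist_eq_one_iff_adj.1 hz.2
    have hxy := ((dist_eq_two_iff hc hb x y).1 hy).1
    rw [Set.ncard_eq_one]
    refine ⟨z, Set.eq_singleton_iff_unique_mem.2 ⟨⟨⟨hxz, hyz⟩, dist_self⟩, ?_⟩⟩
    rintro w ⟨⟨hw1, hw2⟩, -⟩
    exact h.unique' ((hb _ _ hw1).1 hx) hxy hw1 hw2 hxz hyz
  · refine ⟨0, fun x hx y hy z hz ↦ ?_⟩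
    obtain ⟨hxy, a, ha1, ha2⟩ := (dist_eq_two_iff hc hb x y).1 hy
    obtain ⟨hxz, b, hb1, hb2⟩ := (dist_eq_two_iff hc hb x z).1 hz.1
    obtain ⟨hyz, c, hc1, hc2⟩ := (dist_eq_two_iff hc hb y z).1 hz.2
    have haY := (hb _ _ ha1).1 hx
    have hyY := (hb _ _ ha2).2 haY
    have h1 := h.mem_left_iff haY hxy ha1 ha2
    have h2 := h.mem_left_iff ((hb _ _ hb1).1 hx) hxz hb1 hb2
    have h3 := h.mem_left_iff ((hb _ _ hc1).1 hyY) hyz hc1 hc2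
    -- Three pairwise joined vertices cannot alternate between two parts, so no such `z` exists and
    -- the constant `0` is arbitrary.
    tauto
  · refine ⟨0, fun x hx y hy z hz ↦ ?_⟩
    have hxy := ((dist_eq_two_iff hc hb x y).1 hy).1
    rw [Set.ncard_eq_zero, Set.eq_empty_iff_forall_notMem]
    rintro w ⟨⟨hw1, hw2⟩, hw3⟩
    obtain ⟨hzw, p, hp1, hp2⟩ := (dist_eq_two_iff hc hb z w).1 hw3
    have hx3 : G.dist x z = 3 := hz.1
    have hy3 : G.dist y z = 3 := hz.2
    -- The only ends of `w` are `x` and `y`, so one of them is `p`, a neighbour of `z`.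
    rcases h.eq_or_eq ((hb _ _ hw1).1 hx) hxy hw1 hw2 hp2.symm with rfl | rfl
    · have := dist_eq_one_iff_adj.2 hp1.symm
      omega
    · have := dist_eq_one_iff_adj.2 hp1.symm
      omega

theorem hasIntersectionNumberC [Finite V] (h : IsBicliqueSubdivision G Y A B) (hc : G.Connected)
    (hb : ∀ u v, G.Adj u v → (u ∈ Y ↔ v ∉ Y)) : HasIntersectionNumberC G Yᶜ 2 1 := by
  have hAY : A ⊆ Y := h.union_eq ▸ Set.subset_union_left
  have hB2 := h.symm.two_le
  have hA2 := h.two_le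
  constructor
  · obtain ⟨p, hp⟩ := Set.nonempty_of_ncard_ne_zero (s := A) (by omega)
    obtain ⟨q, hq⟩ := Set.nonempty_of_ncard_ne_zero (s := B) (by omega)
    obtain ⟨w, hw, -⟩ := h.join p hp q hq
    exact ⟨w, (hb _ _ hw).1 (hAY hp)⟩
  intro w hw
  constructor
  · obtain ⟨p, hp, q, hq, hpq⟩ := h.ends w hw
    obtain ⟨q', hq', hne⟩ := Set.exists_ne_of_one_lt_ncard hB2 q
    obtain ⟨w', hw1, hw2⟩ := h.join p hp q' hq'
    refine ⟨w', (dist_eq_two_iff hc hb w w').2 ⟨?_, p, ((hpq p).2 (.inl rfl)).symm, hw1.symm⟩⟩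
    rintro rfl
    rcases (hpq q').1 hw2 with rfl | h1
    · exact Set.disjoint_left.1 h.disjoint hp hq'
    · exact hne h1
  · intro v hv
    obtain ⟨hne, x, hx1, hx2⟩ := (dist_eq_two_iff hc hb w v).1 hv
    unfold cNum
    rw [Set.ncard_eq_one]
    refine ⟨x, Set.eq_singleton_iff_unique_mem.2 ⟨⟨?_, hx2⟩, ?_⟩⟩
    · simpa using hx1
    · rintro y ⟨hy, hy2⟩
      have hy : G.dist w y + 1 = 2 := hy
      have hy1 : G.Adj w y := dist_eq_one_iff_adj.1 (by omega)
      by_contra hxy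
      exact hne (h.unique' hw hxy hy1.symm hx1.symm hy2.symm hx2.symm)

end IsBicliqueSubdivision

/-! ### Partial linear spaces with points of eccentricity `4`. -/

/-- A connected graph with bipartition `Y`, `Yᶜ` in which two vertices have at most one common
neighbour: the incidence graph of a connected partial linear space with point set `Y`. -/
structure IsPartialLinear {V : Type*} (G : SimpleGraph V) (Y : Set V) : Prop where
  connected : G.Connected
  adj : ∀ u v, G.Adj u v → (u ∈ Y ↔ v ∉ Y)
  unique : ∀ x y w w', x ≠ y → G.Adj x w → G.Adj y w → G.Adj x w' → G.Adj y w' → w = w'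

open SimpleGraph in
theorem HasIntersectionNumberC.isPartialLinear {V : Type*} {G : SimpleGraph V} {Y : Set V}
    (h : HasIntersectionNumberC G Yᶜ 2 1) (hc : G.Connected)
    (hb : ∀ u v, G.Adj u v → (u ∈ Y ↔ v ∉ Y)) : IsPartialLinear G Y := by
  have key : ∀ x y w w', w ∉ Y → w' ∉ Y → x ≠ y → G.Adj x w → G.Adj y w → G.Adj x w' →
      G.Adj y w' → w = w' := by
    intro x y w w' hw hw' hxy h1 h2 h3 h4
    by_contra hne
    have hd := (dist_eq_two_iff hc hb w w').2 ⟨hne, x, h1.symm, h3.symm⟩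
    have hcn := (h.2 w hw).2 w' hd
    unfold cNum at hcn
    obtain ⟨z, hz⟩ := Set.ncard_eq_one.1 hcn
    have hx : x ∈ ({z} : Set V) := hz ▸ ⟨by simpa using h1.symm, h3.symm⟩
    have hy : y ∈ ({z} : Set V) := hz ▸ ⟨by simpa using h2.symm, h4.symm⟩
    exact hxy (hx.trans hy.symm)
  refine ⟨hc, hb, fun x y w w' hxy h1 h2 h3 h4 ↦ ?_⟩
  -- If `w` and `w'` are points, the roles of the two pairs are exchanged.
  by_cases hw : w ∈ Y
  · by_contra hne
    refine hxy (key w w' x y ?_ ?_ hne h1.symm h3.symm h2.symm h4.symm)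
    · exact (hb _ _ h1.symm).1 hw
    · exact (hb _ _ h2.symm).1 hw
  · have hw' : w' ∉ Y := (hb _ _ h3).1 ((hb _ _ h1).2 hw)
    exact key x y w w' hw hw' hxy h1 h2 h3 h4

namespace IsPartialLinear

open SimpleGraph

variable {V : Type*} {G : SimpleGraph V} {Y : Set V}

theorem dist_eq_two_iff (h : IsPartialLinear G Y) (u v : V) :
    G.dist u v = 2 ↔ u ≠ v ∧ ∃ w, G.Adj u w ∧ G.Adj v w :=
  SimpleGraph.dist_eq_two_iff h.connected h.adj u v

theorem dist_eq_three (h : IsPartialLinear G Y) (hD : ∀ x ∈ Y, G.eccent x = (4 : ℕ))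
    {x w : V} (hx : x ∈ Y) (hw : w ∉ Y) (hxw : ¬ G.Adj x w) : G.dist x w = 3 := by
  have h1 := dist_le_of_eccent_eq h.connected (hD x hx) w
  have h2 : ¬ Even (G.dist x w) := by
    rw [even_dist_iff h.connected h.adj]
    tauto
  have h3 : G.dist x w ≠ 1 := fun h1 ↦ hxw (dist_eq_one_iff_adj.1 h1)
  rw [Nat.not_even_iff_odd] at h2
  obtain ⟨k, hk⟩ := h2
  omega

/-- Every point is the start of a geodesic of length `4`. -/
theorem exists_dist_four [Finite V] (h : IsPartialLinear G Y)
    (hD : ∀ x ∈ Y, G.eccent x = (4 : ℕ)) {x : V} (hx : x ∈ Y) :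
    ∃ w p w' y, G.dist x y = 4 ∧ G.Adj x w ∧ G.Adj p w ∧ G.Adj p w' ∧ G.Adj y w' ∧
      ¬ G.Adj x w' ∧ x ≠ p ∧ p ≠ y ∧ w ≠ w' := by
  obtain ⟨y, hy⟩ := exists_dist_eq_of_eccent_eq h.connected (hD x hx)
  obtain ⟨w, p, w', h1, h2, h3, h4⟩ := exists_path_of_dist_eq_four h.connected hy
  have hxy : x ≠ y := by
    rintro rfl
    simp at hy
  have hn : ∀ v, G.Adj x v → G.Adj y v → False := by
    intro v ha hb
    have := (h.dist_eq_two_iff x y).2 ⟨hxy, v, ha, hb⟩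
    omega
  have hxp : x ≠ p := by
    rintro rfl
    exact hn _ h3 h4.symm
  refine ⟨w, p, w', y, hy, h1, h2.symm, h3, h4.symm, fun h5 ↦ hn _ h5 h4.symm, hxp, ?_, ?_⟩
  · rintro rfl
    exact hn _ h1 h2.symm
  · rintro rfl
    exact hn _ h1 h4.symm

theorem ncard_neighborSet_eq_of_adj [Finite V] (h : IsPartialLinear G Y)
    (hreg : ∀ x, IsDistanceRegularizedVertex G x) {m u v : V} (hu : G.Adj u m) (hv : G.Adj v m) :
    (G.neighborSet u).ncard = (G.neighborSet v).ncard :=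
  SimpleGraph.ncard_neighborSet_eq_of_adj h.connected h.adj (hreg m) hu hv

/-- Vertices of one colour are joined by a walk of even length, and two steps of it preserve the
degree. -/
theorem ncard_neighborSet_eq [Finite V] (h : IsPartialLinear G Y)
    (hreg : ∀ x, IsDistanceRegularizedVertex G x) {u v : V} (huv : u ∈ Y ↔ v ∈ Y) :
    (G.neighborSet u).ncard = (G.neighborSet v).ncard := by
  obtain ⟨p, hp⟩ := h.connected.exists_walk_length_eq_dist u v
  have hpe : Even p.length := hp ▸ (even_dist_iff h.connected h.adj u v).2 huv
  clear hp huv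
  generalize hk : p.length = k at hpe
  induction k using Nat.strong_induction_on generalizing u with
  | _ k ih =>
    match p, hk with
    | .nil, _ => rfl
    | .cons h1 .nil, hk =>
      subst hk
      simp at hpe
    | .cons h1 (.cons h2 q), hk =>
      rw [h.ncard_neighborSet_eq_of_adj hreg h1 h2.symm]
      simp only [Walk.length_cons] at hk
      refine ih q.length (by omega) q rfl ?_
      rw [← hk] at hpe
      simpa [Nat.even_add_one] using hpe

/-- Lines of a `2`-homogeneous space of eccentricity `4` do not have three points. -/
theorem ncard_neighborSet_le_two [Finite V] (h : IsPartialLinear G Y)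
    (hreg : ∀ x, IsDistanceRegularizedVertex G x) (hD : ∀ x ∈ Y, G.eccent x = (4 : ℕ))
    (hom : IsTwoHomogeneous G Y 4) (hne : Y.Nonempty) {l : V} (hl : l ∉ Y) :
    (G.neighborSet l).ncard ≤ 2 := by
  by_contra! hlt
  have hY : ∀ {x w}, G.Adj x w → w ∉ Y → x ∈ Y := fun hxw hw ↦ (h.adj _ _ hxw).2 hw
  have hL : ∀ {x w}, G.Adj x w → x ∈ Y → w ∉ Y := fun hxw hw ↦ (h.adj _ _ hxw).1 hw
  have hdeg : ∀ w ∉ Y, 2 < (G.neighborSet w).ncard := fun w hw ↦ by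
    rwa [← h.ncard_neighborSet_eq hreg (iff_of_false hl hw)]
  have two : ∀ w ∉ Y, ∀ p, ∃ a b, a ≠ b ∧ a ≠ p ∧ b ≠ p ∧ G.Adj a w ∧ G.Adj b w := by
    intro w hw p
    have h1 : 1 < (G.neighborSet w \ {p}).ncard := by
      have := Set.le_ncard_sdiff {p} (G.neighborSet w)
      have := hdeg w hw
      rw [Set.ncard_singleton] at *
      omega
    obtain ⟨a, b, ha, hb, hab⟩ := (Set.one_lt_ncard_iff).1 h1
    exact ⟨a, b, hab, ha.2, hb.2, ha.1.symm, hb.1.symm⟩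
  obtain ⟨x, hx⟩ := hne
  obtain ⟨l₁, p, m, y, -, hxl, hpl, hpm, hym, hxm, hxp, hpy, hlm⟩ := h.exists_dist_four hD hx
  have hl₁ := hL hxl hx
  have hp := hY hpl hl₁
  have hm := hL hpm hp
  obtain ⟨γ₃, hγ₃⟩ := hom 3 (by norm_num) (by norm_num)
  obtain ⟨γ₂, hγ₂⟩ := hom 2 (by norm_num) (by norm_num)
  -- Two points of `l₁` other than `p` are at distance `3` from `m`, since `m` meets `l₁` only in
  -- `p`; their line `l₁` is at distance `2` from `m`.
  have hγ₃pos : γ₃ ≠ 0 := by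
    obtain ⟨a, b, hab, hap, hbp, ha, hb⟩ := two l₁ hl₁ p
    have ha' : ¬ G.Adj a m := fun hh ↦ hlm (h.unique a p _ _ hap ha hpl hh hpm)
    have hb' : ¬ G.Adj b m := fun hh ↦ hlm (h.unique b p _ _ hbp hb hpl hh hpm)
    rw [← hγ₃ a (hY ha hl₁) b ((h.dist_eq_two_iff a b).2 ⟨hab, l₁, ha, hb⟩) m
      ⟨h.dist_eq_three hD (hY ha hl₁) hm ha', h.dist_eq_three hD (hY hb hl₁) hm hb'⟩]
    exact Set.ncard_ne_zero_of_mem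
      ⟨⟨ha, hb⟩, (h.dist_eq_two_iff m l₁).2 ⟨hlm.symm, p, hpm.symm, hpl.symm⟩⟩
  -- Three points of one line: the line of two of them contains the third.
  have hγ₂pos : γ₂ ≠ 0 := by
    obtain ⟨a, b, hab, hap, hbp, ha, hb⟩ := two l₁ hl₁ p
    rw [← hγ₂ a (hY ha hl₁) b ((h.dist_eq_two_iff a b).2 ⟨hab, l₁, ha, hb⟩) p
      ⟨(h.dist_eq_two_iff a p).2 ⟨hap, l₁, ha, hpl⟩, (h.dist_eq_two_iff b p).2 ⟨hbp, l₁, hb, hpl⟩⟩]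
    exact Set.ncard_ne_zero_of_mem ⟨⟨ha, hb⟩, dist_eq_one_iff_adj.2 hpl⟩
  -- `x` lies on as many lines as `p`, which is on both `l₁` and `m`.
  obtain ⟨l₂, hxl₂, hl₂⟩ : ∃ l₂, G.Adj x l₂ ∧ l₂ ≠ l₁ := by
    have h1 : 1 < (G.neighborSet x).ncard := by
      rw [h.ncard_neighborSet_eq_of_adj hreg hxl hpl]
      exact (Set.one_lt_ncard_iff).2 ⟨l₁, m, hpl, hpm, hlm⟩
    obtain ⟨l₂, h2, h3⟩ := Set.exists_ne_of_one_lt_ncard h1 l₁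
    exact ⟨l₂, h2, h3⟩
  have hl₂Y := hL hxl₂ hx
  have hl₂m : l₂ ≠ m := by
    rintro rfl
    exact hxm hxl₂
  -- Otherwise two points of `l₂` are at distance `3` from `m`, and `γ₃ ≠ 0` makes their line `l₂`
  -- meet `m` after all.
  obtain ⟨q, hql, hqm⟩ : ∃ q, G.Adj q l₂ ∧ G.Adj q m := by
    by_contra! hno
    obtain ⟨a, b, hab, -, -, ha, hb⟩ := two l₂ hl₂Y x
    have hmem := hγ₃ a (hY ha hl₂Y) b ((h.dist_eq_two_iff a b).2 ⟨hab, l₂, ha, hb⟩) m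
      ⟨h.dist_eq_three hD (hY ha hl₂Y) hm (hno a ha), h.dist_eq_three hD (hY hb hl₂Y) hm (hno b hb)⟩
    obtain ⟨l₃, ⟨h1, h2⟩, h3⟩ := Set.nonempty_of_ncard_ne_zero (hmem.trans_ne hγ₃pos)
    obtain rfl := h.unique a b _ _ hab h1 h2 ha hb
    obtain ⟨-, q, h4, h5⟩ := (h.dist_eq_two_iff _ _).1 h3
    exact hno q h5.symm h4.symm
  have hxq : x ≠ q := by
    rintro rfl
    exact hxm hqm
  have hpq : p ≠ q := by
    rintro rfl
    exact hl₂ (h.unique x p _ _ hxp hxl₂ hql hxl hpl)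
  -- `x`, `p`, `q` form a triangle with sides `l₁`, `l₂`, `m`, but `γ₂ ≠ 0` puts `q` on `l₁`.
  have hmem := hγ₂ x hx p ((h.dist_eq_two_iff x p).2 ⟨hxp, l₁, hxl, hpl⟩) q
    ⟨(h.dist_eq_two_iff x q).2 ⟨hxq, l₂, hxl₂, hql⟩, (h.dist_eq_two_iff p q).2 ⟨hpq, m, hpm, hqm⟩⟩
  obtain ⟨l₃, ⟨h1, h2⟩, h3⟩ := Set.nonempty_of_ncard_ne_zero (hmem.trans_ne hγ₂pos)
  obtain rfl := h.unique x p _ _ hxp h1 h2 hxl hpl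
  have hql₁ : G.Adj q l₃ := dist_eq_one_iff_adj.1 h3
  exact hl₂ (h.unique x q _ _ hxq hxl₂ hql hxl hql₁)

theorem two_le_ncard_neighborSet [Finite V] (h : IsPartialLinear G Y)
    (hreg : ∀ x, IsDistanceRegularizedVertex G x) (hD : ∀ x ∈ Y, G.eccent x = (4 : ℕ))
    (hne : Y.Nonempty) {l : V} (hl : l ∉ Y) : 2 ≤ (G.neighborSet l).ncard := by
  obtain ⟨x, hx⟩ := hne
  obtain ⟨w, p, -, -, -, hxw, hpw, -, -, -, hxp, -⟩ := h.exists_dist_four hD hx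
  rw [h.ncard_neighborSet_eq hreg (iff_of_false hl ((h.adj _ _ hxw).1 hx))]
  exact (Set.one_lt_ncard_iff).2 ⟨x, p, hxw.symm, hpw.symm, hxp⟩

/-- If all lines have two points, then exactly one point of a line missing `x` is collinear
with `x`. -/
theorem dist_eq_two_iff_of_not_adj [Finite V] (h : IsPartialLinear G Y)
    (hreg : ∀ x, IsDistanceRegularizedVertex G x) (hD : ∀ x ∈ Y, G.eccent x = (4 : ℕ))
    (hlines : ∀ l ∉ Y, (G.neighborSet l).ncard = 2) {x p q m : V} (hx : x ∈ Y) (hxm : ¬ G.Adj x m)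
    (hpq : p ≠ q) (hp : G.Adj p m) (hq : G.Adj q m) (hm : m ∉ Y) :
    G.dist x p = 2 ↔ G.dist x q ≠ 2 := by
  have hpair : ∀ {a b w}, w ∉ Y → a ≠ b → G.Adj a w → G.Adj b w → G.neighborSet w = {a, b} := by
    intro a b w hw hab ha hb
    refine (Set.eq_of_subset_of_ncard_le ?_ ?_).symm
    · rintro _ (rfl | rfl)
      exacts [ha.symm, hb.symm]
    · rw [hlines w hw, Set.ncard_pair hab]
  -- By regularity `c_3` may be computed at the last line of a geodesic of length `4`: of its two
  -- points, one is at distance `2` from `x` and the other at distance `4`.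
  have hcm : cNum G 3 x m = 1 := by
    obtain ⟨w, r, m', y, hxy, hxw, hrw, hrm, hym, hxm', hxr, hry, -⟩ := h.exists_dist_four hD hx
    have hm' : m' ∉ Y := (h.adj _ _ hrm).1 ((h.adj _ _ hrw).2 ((h.adj _ _ hxw).1 hx))
    rw [(hreg x 3 m (h.dist_eq_three hD hx hm hxm) m' (h.dist_eq_three hD hx hm' hxm')).2.2]
    unfold cNum
    rw [hpair hm' hry hrm hym, Set.ncard_eq_one]
    have hxr2 := (h.dist_eq_two_iff x r).2 ⟨hxr, w, hxw, hrw⟩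
    refine ⟨r, Set.eq_singleton_iff_unique_mem.2 ⟨⟨by simp [hxr2], .inl rfl⟩, ?_⟩⟩
    rintro z ⟨hz, rfl | rfl⟩
    · rfl
    · have hz : G.dist x z + 1 = 3 := hz
      omega
  unfold cNum at hcm
  rw [hpair hm hpq hp hq] at hcm
  obtain ⟨z, hz⟩ := Set.ncard_eq_one.1 hcm
  have hzp : z ∈ {v | G.dist x v + 1 = 3} ∩ ({p, q} : Set V) := hz ▸ rfl
  constructor
  · intro h1 h2
    have e1 : p ∈ ({z} : Set V) := hz ▸ ⟨by simp [h1], .inl rfl⟩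
    have e2 : q ∈ ({z} : Set V) := hz ▸ ⟨by simp [h2], .inr rfl⟩
    exact hpq (e1.trans e2.symm)
  · intro h1
    obtain ⟨h2, rfl | rfl⟩ := hzp
    · have h2 : G.dist x z + 1 = 3 := h2
      omega
    · have h2 : G.dist x z + 1 = 3 := h2
      omega

/-- If all lines have two points, a point is collinear with as many points as there are lines
through it. -/
theorem ncard_dist_eq_two [Finite V] (h : IsPartialLinear G Y)
    (hlines : ∀ l ∉ Y, (G.neighborSet l).ncard = 2) {x : V} (hx : x ∈ Y) :
    {y | G.dist x y = 2}.ncard = (G.neighborSet x).ncard := by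
  have hjoin : ∀ y, ∀ _ : y ∈ {y | G.dist x y = 2}, ∃ w, G.Adj x w ∧ G.Adj y w :=
    fun y hy ↦ ((h.dist_eq_two_iff x y).1 hy).2
  choose f hf1 hf2 using hjoin
  have hne : ∀ y ∈ {y | G.dist x y = 2}, y ≠ x := fun y hy ↦ ((h.dist_eq_two_iff x y).1 hy).1.symm
  refine Set.ncard_congr f (fun y hy ↦ hf1 y hy) ?_ ?_
  · intro y z hy hz hyz
    by_contra hyz'
    have hlt : 2 < (G.neighborSet (f y hy)).ncard :=
      (Set.two_lt_ncard_iff).2 ⟨x, y, z, (hf1 y hy).symm, (hf2 y hy).symm,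
        hyz ▸ (hf2 z hz).symm, (hne y hy).symm, (hne z hz).symm, hyz'⟩
    rw [hlines _ ((h.adj _ _ (hf1 y hy)).1 hx)] at hlt
    omega
  · intro w hw
    have hw : G.Adj x w := hw
    obtain ⟨y, hy, hyx⟩ := Set.exists_ne_of_one_lt_ncard
      (by rw [hlines _ ((h.adj _ _ hw).1 hx)]; norm_num : 1 < (G.neighborSet w).ncard) x
    have hd : G.dist x y = 2 := (h.dist_eq_two_iff x y).2 ⟨hyx.symm, w, hw, hy.symm⟩
    exact ⟨y, hd, h.unique x y _ _ hyx.symm (hf1 y hd) (hf2 y hd) hw hy.symm⟩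

/-- The parts are the points collinear with a fixed point `x`, and all other points, `x` included.
-/
theorem exists_isBicliqueSubdivision [Finite V] (h : IsPartialLinear G Y)
    (hreg : ∀ x, IsDistanceRegularizedVertex G x) (hD : ∀ x ∈ Y, G.eccent x = (4 : ℕ))
    (hne : Y.Nonempty) (hlines : ∀ l ∉ Y, (G.neighborSet l).ncard = 2) :
    ∃ A B, IsBicliqueSubdivision G Y A B := by
  obtain ⟨x, hx⟩ := hne
  have hY : ∀ {x w}, G.Adj x w → w ∉ Y → x ∈ Y := fun hxw hw ↦ (h.adj _ _ hxw).2 hw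
  have hL : ∀ {x w}, G.Adj x w → x ∈ Y → w ∉ Y := fun hxw hw ↦ (h.adj _ _ hxw).1 hw
  have hpts : ∀ w ∉ Y, ∃ a b, a ≠ b ∧ ∀ v, G.Adj v w ↔ v = a ∨ v = b := by
    intro w hw
    obtain ⟨a, b, hab, hs⟩ := Set.ncard_eq_two.1 (hlines w hw)
    refine ⟨a, b, hab, fun v ↦ ?_⟩
    rw [G.adj_comm, ← mem_neighborSet, hs]
    simp
  have exch := @h.dist_eq_two_iff_of_not_adj _ _ _ _ hreg hD hlines
  set A := {y | G.dist x y = 2} with hA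
  have hAY : A ⊆ Y := by
    intro a ha
    obtain ⟨-, w, h1, h2⟩ := (h.dist_eq_two_iff x a).1 ha
    exact hY h2 (hL h1 hx)
  have hends : ∀ w ∉ Y, ∀ a b, a ≠ b → G.Adj a w → G.Adj b w → (a ∈ A ↔ b ∉ A) := by
    intro w hw a b hab ha hb
    by_cases hxw : G.Adj x w
    · obtain ⟨p, q, hpq, hs⟩ := hpts w hw
      have key : ∀ v, G.Adj v w → (v ∈ A ↔ v ≠ x) := fun v hv ↦
        (h.dist_eq_two_iff x v).trans ⟨fun hh ↦ hh.1.symm, fun hh ↦ ⟨hh.symm, w, hxw, hv⟩⟩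
      rw [key a ha, key b hb]
      rw [hs] at ha hb hxw
      grind
    · exact exch hx hxw hab ha hb hw
  have hjoin : ∀ p ∈ A, ∀ q ∈ Y \ A, ∃ w, G.Adj p w ∧ G.Adj q w := by
    rintro p hp q ⟨hqY, hq⟩
    obtain ⟨hxp, w, h1, h2⟩ := (h.dist_eq_two_iff x p).1 hp
    by_cases hqw : G.Adj q w
    · exact ⟨w, h2, hqw⟩
    · have h3 : G.dist q x ≠ 2 := by rwa [dist_comm]
      have h4 := (exch hqY hqw hxp.symm h2 h1 (hL h1 hx)).2 h3
      -- The line `w` through `x` and `p` misses `q`, and `q` is not collinear with `x`, hence it is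
      -- with `p`.
      obtain ⟨-, v, h5, h6⟩ := (h.dist_eq_two_iff q p).1 h4
      exact ⟨v, h6, h5⟩
  obtain ⟨w, p, -, y, hxy, hxw, hpw, -, -, -, hxp, -⟩ := h.exists_dist_four hD hx
  have hpA : p ∈ A := (h.dist_eq_two_iff x p).2 ⟨hxp, w, hxw, hpw⟩
  -- Both parts are thus neighbourhoods of points, so their sizes agree.
  have hpB : {y | G.dist p y = 2} = Y \ A := by
    ext z
    constructor
    · intro hz
      obtain ⟨hpz, v, h1, h2⟩ := (h.dist_eq_two_iff p z).1 hz
      have hv := hL h1 (hAY hpA)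
      exact ⟨hY h2 hv, (hends v hv p z hpz h1 h2).1 hpA⟩
    · intro hz
      exact (h.dist_eq_two_iff p z).2 ⟨fun hpz ↦ hz.2 (hpz ▸ hpA), hjoin p hpA z hz⟩
  have hcard : A.ncard = (Y \ A).ncard := by
    rw [← hpB, h.ncard_dist_eq_two hlines hx, h.ncard_dist_eq_two hlines (hAY hpA)]
    exact h.ncard_neighborSet_eq hreg (iff_of_true hx (hAY hpA))
  refine ⟨A, Y \ A, Set.union_sdiff_cancel hAY, Set.disjoint_sdiff_right, hcard, ?_, ?_, hjoin, ?_⟩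
  · rw [hcard]
    have hyY : y ∈ Y := ((even_dist_iff h.connected h.adj x y).1 (by rw [hxy]; decide)).1 hx
    -- The second part contains `x` and a point at distance `4` from it.
    refine (Set.one_lt_ncard_iff).2 ⟨x, y, ⟨hx, by simp [hA]⟩, ⟨hyY, by simp [hA, hxy]⟩, ?_⟩
    rintro rfl
    simp at hxy
  · intro w hw
    obtain ⟨a, b, hab, hs⟩ := hpts w hw
    have ha := (hs a).2 (.inl rfl)
    have hb := (hs b).2 (.inr rfl)
    have hab' := hends w hw a b hab ha hb
    by_cases haA : a ∈ A
    · exact ⟨a, haA, b, ⟨hY hb hw, hab'.1 haA⟩, hs⟩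
    · exact ⟨b, by tauto, a, ⟨hY ha hw, haA⟩, fun v ↦ (hs v).trans or_comm⟩
  · intro p hp q hq w w' h1 h2 h3 h4
    exact h.unique p q _ _ (fun hpq ↦ hq.2 (hpq ▸ hp)) h1 h2 h3 h4

end IsPartialLinear

theorem mainTheorem4 {V : Type*} [Finite V] (G : SimpleGraph V) (Y Y' : Set V)
    (hG : IsBipartiteDistanceRegularized G Y Y') :
    (HasCommonEccentricity G Y 4 ∧ IsTwoHomogeneous G Y 4 ∧ HasIntersectionNumberC G Y' 2 1) ↔
      ∃ n : ℕ, 2 ≤ n ∧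
        ∃ φ : G ≃g subdivisionGraph (completeBipartiteGraph (Fin n) (Fin n)),
          φ '' Y = Set.range Sum.inl := by
  have hc := hG.connected
  obtain rfl : Y' = Yᶜ := by
    refine (IsCompl.compl_eq ⟨hG.bipartite.disjoint, ?_⟩).symm
    exact codisjoint_iff.2 hG.cover
  have hb : ∀ u v, G.Adj u v → (u ∈ Y ↔ v ∉ Y) := by
    intro u v huv
    have := hG.bipartite.mem_of_adj huv
    simp only [Set.mem_compl_iff] at this
    tauto
  constructor
  · rintro ⟨⟨hne, hD⟩, hom, hC⟩
    have h := hC.isPartialLinear hc hb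
    obtain ⟨A, B, hAB⟩ := h.exists_isBicliqueSubdivision hG.regularized hD hne fun l hl ↦
      (h.ncard_neighborSet_le_two hG.regularized hD hom hne hl).antisymm
        (h.two_le_ncard_neighborSet hG.regularized hD hne hl)
    exact ⟨A.ncard, hAB.two_le, hAB.exists_iso hb⟩
  · rintro ⟨n, hn, φ, hφ⟩
    have h := IsBicliqueSubdivision.of_iso hn φ hφ
    exact ⟨h.hasCommonEccentricity hc hb, h.isTwoHomogeneous hc hb, h.hasIntersectionNumberC hc hb⟩
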